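/- Let $A$ be a finite totally ordered alphabet and $A^*$ the free monoid on $A$. For a word $w=a_1\cdots a_n\in A^*$ let $P(w)$ be its Schensted tableau, obtained by row-inserting $a_1$, then $a_2$, …, then $a_n$ into the empty tableau; here inserting a letter $x$ into a weakly increasing row replaces the leftmost letter $y>x$ by $x$ and inserts the bumped letter $y$ into the next row, or appends $x$ at the end of the row if no letter is larger than $x$. Let $\lambda(w)$ be the shape of $P(w)$, i.e. the integer partition whose parts are the lengths of the rows of $P(w)$. The plactic equivalence on $A^*$ is defined by $u\equiv_{plax}v\Leftrightarrow P(u)=P(v)$. (i) The plactic equivalence is the left syntactic congruence of $\lambda$: for all $u,v\in A^*$, $$u\equiv_{plax}v\iff \lambda(xu)=\lambda(xv)\text{ for all }x\in A^*.$$ (ii) The plactic equivalence is the (two-sided) syntactic congruence of $\lambda$: for all $u,v\in A^*$, $$u\equiv_{plax}v\iff \lambda(xuy)=\lambda(xvy)\text{ for all }x,y\in A^*.$$ In particular $\equiv_{plax}$ is a monoid congruence on $A^*$, and the plactic monoid $A^*/{\equiv_{plax}}$ is the syntactic monoid of $\lambda$, i.e. the quotient of $A^*$ by the syntactic congruence of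 $\lambda$: there is an isomorphism between them that is compatible with the canonical projections from $A^*$. -/

import Mathlib

namespace Plactic

section Tableaux

variable {A : Type*} [LinearOrder A]

/-- `Fits r s`: the row `s` may be placed directly on top of the row `r` (both left-justified),
that is, `s` is not longer than `r` and each letter of `s` is strictly larger than the letter of
`r` just below it. -/
def Fits : List A → List A → Prop
  | _, [] => True
  | [], _ :: _ => False
  | a :: r, b :: s => a < b ∧ Fits r s

/-- A (semistandard Young) tableau, given by the list of its rows, starting with the bottom row
(French convention).  The letters increase weakly from left to right in each row and strictly from
bottom to top in each column. -/
@[ext]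
structure Tableau (A : Type*) [LinearOrder A] where
  /-- The rows, from bottom to top. -/
  rows : List (List A)
  rows_ne_nil : ∀ r ∈ rows, r ≠ []
  row_weak : ∀ r ∈ rows, r.Pairwise (· ≤ ·)
  col_strict : rows.IsChain Fits

/-- The set of all integer partitions (of all natural numbers). -/
abbrev Partitions : Type := Σ n : ℕ, n.Partition

/-- The shape of a tableau: the partition whose parts are the lengths of the rows. -/
def Tableau.shape (T : Tableau A) : Partitions :=
  ⟨((T.rows.map List.length : List ℕ) : Multiset ℕ).sum,
    { parts := ((T.rows.map List.length : List ℕ) : Multiset ℕ)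
      parts_pos := by
        intro i hi
        obtain ⟨r, hr, rfl⟩ := List.mem_map.1 (Multiset.mem_coe.1 hi)
        exact List.length_pos_iff.2 (T.rows_ne_nil r hr)
      parts_sum := rfl }⟩

/-- Row insertion of the letter `x` into a row: the new row and the bumped letter, if any.  The
letter `x` replaces the leftmost letter that is larger than `x` (which is then bumped), and is
appended at the end of the row if there is no such letter. -/
def rowInsert (x : A) : List A → List A × Option A
  | [] => ([x], none)
  | y :: r => if x < y then (x :: r, some y) else (y :: (rowInsert x r).1, (rowInsert x r).2)

/-- Row insertion of the letter `x` into a list of rows, starting with the first row: the bumped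
letter, if any, is inserted into the next row. -/
def insertRows (x : A) : List (List A) → List (List A)
  | [] => [[x]]
  | r :: T =>
    match (rowInsert x r).2 with
    | none => (rowInsert x r).1 :: T
    | some y => (rowInsert x r).1 :: insertRows y T

theorem rowInsert_ne_nil (x : A) (r : List A) : (rowInsert x r).1 ≠ [] := by
  cases r with
  | nil => simp [rowInsert]
  | cons y r => by_cases h : x < y <;> simp [rowInsert, h]

theorem mem_rowInsert {x z : A} {r : List A} (h : z ∈ (rowInsert x r).1) : z = x ∨ z ∈ r := by
  induction r with
  | nil => simpa [rowInsert] using h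
  | cons y r ih =>
    by_cases hxy : x < y
    · simp only [rowInsert, hxy, if_true, List.mem_cons] at h ⊢
      tauto
    · simp only [rowInsert, hxy, if_false, List.mem_cons] at h ⊢
      tauto

theorem rowInsert_pairwise (x : A) {r : List A} (h : r.Pairwise (· ≤ ·)) :
    (rowInsert x r).1.Pairwise (· ≤ ·) := by
  induction r with
  | nil => simp [rowInsert]
  | cons y r ih =>
    rw [List.pairwise_cons] at h
    by_cases hxy : x < y
    · simp only [rowInsert, hxy, if_true, List.pairwise_cons]
      exact ⟨fun z hz => hxy.le.trans (h.1 z hz), h.2⟩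
    · simp only [rowInsert, hxy, if_false, List.pairwise_cons]
      refine ⟨fun z hz => ?_, ih h.2⟩
      rcases mem_rowInsert hz with rfl | hz
      · exact not_lt.1 hxy
      · exact h.1 z hz

theorem lt_of_rowInsert {x y : A} {r : List A} (h : (rowInsert x r).2 = some y) : x < y := by
  induction r with
  | nil => simp [rowInsert] at h
  | cons z r ih =>
    by_cases hxz : x < z
    · simp only [rowInsert, hxz, if_true, Option.some.injEq] at h
      exact h ▸ hxz
    · simp only [rowInsert, hxz, if_false] at h
      exact ih h

theorem Fits.rowInsert_left (x : A) {r s : List A} (h : Fits r s) :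
    Fits (rowInsert x r).1 s := by
  induction r generalizing s with
  | nil =>
    cases s with
    | nil => simp [Fits]
    | cons c s => simp [Fits] at h
  | cons b r ih =>
    cases s with
    | nil => simp [Fits]
    | cons c s =>
      simp only [Fits] at h
      by_cases hxb : x < b
      · simp only [rowInsert, hxb, if_true, Fits]
        exact ⟨hxb.trans h.1, h.2⟩
      · simp only [rowInsert, hxb, if_false, Fits]
        exact ⟨h.1, ih h.2⟩

theorem Fits.rowInsert_bump {x y : A} {r s : List A} (h : Fits r s)
    (hy : (rowInsert x r).2 = some y) : Fits (rowInsert x r).1 (rowInsert y s).1 := by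
  induction r generalizing s with
  | nil => simp [rowInsert] at hy
  | cons b r ih =>
    have hxy := lt_of_rowInsert hy
    by_cases hxb : x < b
    · simp only [rowInsert, hxb, if_true, Option.some.injEq] at hy ⊢
      subst hy
      cases s with
      | nil => simp [rowInsert, Fits, hxb]
      | cons c s =>
        simp only [Fits] at h
        simp [rowInsert, Fits, hxb, h]
    · simp only [rowInsert, hxb, if_false] at hy ⊢
      have hby : b < y := (not_lt.1 hxb).trans_lt hxy
      cases s with
      | nil => simp [rowInsert, Fits, hby]
      | cons c s =>
        simp only [Fits] at h
        by_cases hyc : y < c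
        · simp only [rowInsert, hyc, if_true, Fits]
          exact ⟨hby, h.2.rowInsert_left x⟩
        · simp only [rowInsert, hyc, if_false, Fits]
          exact ⟨h.1, ih h.2 hy⟩

theorem insertRows_ne_nil (x : A) {T : List (List A)} (h : ∀ r ∈ T, r ≠ []) :
    ∀ r ∈ insertRows x T, r ≠ [] := by
  induction T generalizing x with
  | nil => simp [insertRows]
  | cons r T ih =>
    rw [List.forall_mem_cons] at h
    rw [insertRows]
    split <;> rw [List.forall_mem_cons]
    · exact ⟨rowInsert_ne_nil x r, h.2⟩
    · exact ⟨rowInsert_ne_nil x r, ih _ h.2⟩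

theorem insertRows_row_weak (x : A) {T : List (List A)} (h : ∀ r ∈ T, r.Pairwise (· ≤ ·)) :
    ∀ r ∈ insertRows x T, r.Pairwise (· ≤ ·) := by
  induction T generalizing x with
  | nil => simp [insertRows]
  | cons r T ih =>
    rw [List.forall_mem_cons] at h
    rw [insertRows]
    split <;> rw [List.forall_mem_cons]
    · exact ⟨rowInsert_pairwise x h.1, h.2⟩
    · exact ⟨rowInsert_pairwise x h.1, ih _ h.2⟩

theorem insertRows_col_strict (x : A) {T : List (List A)} (h : T.IsChain Fits) :
    (insertRows x T).IsChain Fits := by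
  induction T generalizing x with
  | nil => simp [insertRows]
  | cons r T ih =>
    rw [insertRows]
    cases T with
    | nil =>
      split
      · simp
      · rename_i y hy
        have : Fits r [] := by simp [Fits]
        simpa [insertRows, rowInsert] using this.rowInsert_bump hy
    | cons s T =>
      rw [List.isChain_cons_cons] at h
      split
      · exact List.isChain_cons_cons.2 ⟨h.1.rowInsert_left x, h.2⟩
      · rename_i y hy
        have h1 := ih y h.2
        have h2 := h.1.rowInsert_bump hy
        rw [insertRows] at h1 ⊢
        split at h1 <;> exact List.isChain_cons_cons.2 ⟨h2, h1⟩

/-- The empty tableau. -/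
def Tableau.empty : Tableau A := ⟨[], by simp, by simp, by simp⟩

/-- Row insertion of a letter into a tableau. -/
def Tableau.insert (T : Tableau A) (x : A) : Tableau A where
  rows := insertRows x T.rows
  rows_ne_nil := insertRows_ne_nil x T.rows_ne_nil
  row_weak := insertRows_row_weak x T.row_weak
  col_strict := insertRows_col_strict x T.col_strict

/-- The tableau `P(w)` of a word `w = a₁ ⋯ aₙ`, obtained by inserting `a₁`, then `a₂`, and so on,
into the empty tableau. -/
def P (w : FreeMonoid A) : Tableau A := (FreeMonoid.toList w).foldl Tableau.insert Tableau.empty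

/-- The function `λ`, which maps a word `w` to the shape of `P(w)`. -/
def shape (w : FreeMonoid A) : Partitions := (P w).shape

/-- The plactic equivalence of words: `u ≡ v` if and only if `P(u) = P(v)`. -/
def placticSetoid (A : Type*) [LinearOrder A] : Setoid (FreeMonoid A) :=
  Setoid.ker (P : FreeMonoid A → Tableau A)

end Tableaux

section Syntactic

variable {A E : Type*}

/-- The left syntactic congruence of a function `f` on words:
`u ≡ v` if and only if `f (x u) = f (x v)` for all words `x`. -/
def leftSyntactic (f : FreeMonoid A → E) : Setoid (FreeMonoid A) where
  r u v := ∀ x, f (x * u) = f (x * v)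
  iseqv := ⟨fun _ _ => rfl, fun h x => (h x).symm, fun h h' x => (h x).trans (h' x)⟩

/-- The (two-sided) syntactic congruence of a function `f` on words:
`u ≡ v` if and only if `f (x u y) = f (x v y)` for all words `x` and `y`. -/
def syntacticCon (f : FreeMonoid A → E) : Con (FreeMonoid A) where
  r u v := ∀ x y, f (x * u * y) = f (x * v * y)
  iseqv := ⟨fun _ _ _ => rfl, fun h x y => (h x y).symm,
    fun h h' x y => (h x y).trans (h' x y)⟩
  mul' := by
    intro u v u' v' h h' x y
    have h1 := h x (u' * y)
    have h2 := h' (x * v) y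
    simp only [mul_assoc] at h1 h2 ⊢
    exact h1.trans h2

/-- The syntactic monoid of a function on words. -/
abbrev SyntacticMonoid (f : FreeMonoid A → E) : Type _ := (syntacticCon f).Quotient

end Syntactic

end Plactic

namespace Plactic

variable {A : Type*} [LinearOrder A]

/-! The proof has two halves.

Plactic equivalence is a congruence. Knuth-related words have the same effect when inserted into any
tableau: passing both through one row yields the same new row and bumped words that are again equal
or Knuth-related (`rowInsertWord_knuth`), so one inducts on the rows. Conversely, row insertion is
itself a chain of Knuth moves on reading words, so every word is congruent to the reading word of `P
w`. Hence `P u = P v` holds exactly when `u` and `v` act equally on all tableaux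
(`insertionCon_iff_P_eq`), a two-sided congruence, and `P u = P v` forces equal shapes in every
context.

Shapes of left multiples determine `P`. Induct on the alphabet by its greatest letter `m`. A tableau
is known from its shape and its subtableau of letters below `m`, which is `P (below m w)`; the shape
is the case of the empty left factor. To reach the subtableau, multiply by `m ^ N` on the left with
`N` large: the copies of `m` fill each row out to the length of the small-letter row beneath it, so
the shape becomes that of `P (below m w)` with one row added (`rowLengths_P_replicate_mul`). Applied
to `x * u` and `x * v`, with `x` over the smaller letters, this supplies the hypothesis of the
induction. -/

/-! ### Knuth relations and row insertion -/

/-- Two words of length three are related by an elementary Knuth transformation. -/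
inductive KnuthStep : List A → List A → Prop
  | yzx {x y z : A} : x < y → y ≤ z → KnuthStep [y, z, x] [y, x, z]
  | xzy {x y z : A} : x ≤ y → y < z → KnuthStep [x, z, y] [z, x, y]

/-- Row insertion of a word into a row: the new row and the word of bumped letters. -/
def rowInsertWord : List A → List A → List A × List A
  | [], r => (r, [])
  | x :: w, r => ((rowInsertWord w (rowInsert x r).1).1,
      (rowInsert x r).2.toList ++ (rowInsertWord w (rowInsert x r).1).2)

/-- Later rows never influence earlier ones, so a word can be passed entirely through the first row
before the bumped word enters the rest. This permits induction on rows. -/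
theorem foldl_insertRows_cons (w r : List A) (T : List (List A)) :
    w.foldl (fun T x => insertRows x T) (r :: T) =
      (rowInsertWord w r).1 :: (rowInsertWord w r).2.foldl (fun T x => insertRows x T) T := by
  induction w generalizing r T with
  | nil => rfl
  | cons x w ih =>
    rw [List.foldl_cons, insertRows]
    split
    · rename_i h
      rw [ih]
      simp [rowInsertWord, h]
    · rename_i y h
      rw [ih]
      simp [rowInsertWord, h]

theorem le_bump {a x b : A} {r : List A} (hr : ∀ c ∈ r, a ≤ c)
    (h : (rowInsert x r).2 = some b) : a ≤ b := by
  induction r with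
  | nil => simp [rowInsert] at h
  | cons c r ih =>
    rw [List.forall_mem_cons] at hr
    by_cases hxc : x < c
    · simp only [rowInsert, hxc, if_true, Option.some.injEq] at h
      exact h ▸ hr.1
    · simp only [rowInsert, hxc, if_false] at h
      exact ih hr.2 h

/-- Letters inserted in weakly increasing order bump letters in weakly increasing order. -/
theorem bump_mono {y z d : A} {r : List A} (hr : r.Pairwise (· ≤ ·)) (hyz : y ≤ z)
    (h : (rowInsert z (rowInsert y r).1).2 = some d) :
    ∃ b ≤ d, (rowInsert y r).2 = some b := by
  induction r with
  | nil => simp [rowInsert, hyz.not_gt] at h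
  | cons a r ih =>
    rw [List.pairwise_cons] at hr
    by_cases hya : y < a
    · simp only [rowInsert, hya, if_true, hyz.not_gt, if_false] at h ⊢
      exact ⟨a, le_bump hr.1 h, rfl⟩
    · have hza : ¬ z < a := fun hza => hya (hyz.trans_lt hza)
      simp only [rowInsert, hya, hza, if_false] at h ⊢
      exact ih hr.2 h

/-- A letter inserted after a strictly larger one bumps some letter, smaller than the one bumped
before. -/
theorem bump_anti {y z : A} {r : List A} (hyz : y < z) :
    ∃ b ≤ z, (rowInsert y (rowInsert z r).1).2 = some b := by
  induction r with
  | nil => exact ⟨z, le_rfl, by simp [rowInsert, hyz]⟩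
  | cons a r ih =>
    by_cases hza : z < a
    · exact ⟨z, le_rfl, by simp [rowInsert, hza, hyz]⟩
    · by_cases hya : y < a
      · exact ⟨a, not_lt.1 hza, by simp [rowInsert, hza, hya]⟩
      · simpa [rowInsert, hza, hya] using ih

/-- Induction on the row, according to which letters bump its head `a`. If none does, `a` is inert
and the tail decides; otherwise the two bumped words are compared directly. The kind of relation may
change: an `xzy` move can come out as a `yzx` move. -/
theorem rowInsertWord_knuth {w w' r : List A} (h : KnuthStep w w') (hr : r.Pairwise (· ≤ ·)) :
    (rowInsertWord w r).1 = (rowInsertWord w' r).1 ∧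
      ((rowInsertWord w r).2 = (rowInsertWord w' r).2 ∨
        KnuthStep (rowInsertWord w r).2 (rowInsertWord w' r).2) := by
  induction r with
  | nil =>
    cases h with
    | yzx h1 h2 => simp [rowInsertWord, rowInsert, h1, h2.not_gt, (h1.trans_le h2).not_gt]
    | xzy h1 h2 =>
      simp [rowInsertWord, rowInsert, h2, h1.not_gt, (h1.trans_lt h2).not_gt, h1.trans_lt h2]
  | cons a r ih =>
    rw [List.pairwise_cons] at hr
    have ih := ih hr.2
    cases h with
    | @yzx x y z hxy hyz =>
      -- Here `y` bumps `a`, then `x` bumps `y`, while `z` may bump some `b ≥ a` from the tail: the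
      -- outputs are `a b y` and `a y b`.
      by_cases hya : y < a
      · have hxz := (hxy.trans_le hyz).not_gt
        simp only [rowInsertWord, rowInsert, hya, hxy, hyz.not_gt, hxz, if_true, if_false, true_and,
          List.append_nil, Option.toList_some, List.cons_append, List.nil_append]
        cases hz : (rowInsert z r).2 with
        | none => simp
        | some b => exact Or.inr (.yzx hya (le_bump hr.1 hz))
      · have hza : ¬ z < a := fun h => hya (hyz.trans_lt h)
        -- Only `x` bumps the head. If `z` bumps `d`, then `y` has bumped some `b ≤ d`, and the
        -- outputs are `b d a` and `b a d`.
        by_cases hxa : x < a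
        · have hxz := (hxy.trans_le hyz).not_gt
          simp only [rowInsertWord, rowInsert, hya, hza, hxa, hxz, if_true, if_false,
            true_and, List.append_nil, Option.toList_some, List.cons_append, List.nil_append]
          cases hz : (rowInsert z (rowInsert y r).1).2 with
          | none => simp
          | some d =>
            obtain ⟨b, hbd, hb⟩ := bump_mono hr.2 hyz hz
            rw [hb]
            exact Or.inr (.yzx ((not_lt.1 hya).trans_lt (lt_of_rowInsert hb)) hbd)
        · simpa [rowInsertWord, rowInsert, hya, hza, hxa] using ih
    | @xzy x y z hxy hyz =>
      have hxz := hxy.trans_lt hyz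
      -- All three letters are below `a`. With `c` the next letter of the row, if any, the outputs
      -- are `a c z` and `a z c`.
      by_cases hza : z < a
      · have hxa := hxz.trans hza
        cases r with
        | nil =>
          simp [rowInsertWord, rowInsert, hza, hxa, hxz.not_gt, hxy.not_gt, hyz, hxz]
        | cons c r =>
          have hac := hr.1 c (by simp)
          simp only [rowInsertWord, rowInsert, hza, hxa, hxz.not_gt, hxz, hxy.not_gt, hyz,
            hza.trans_le hac, (hyz.trans hza).trans_le hac, if_true, if_false, true_and,
            List.append_nil, Option.toList_some, List.cons_append, List.nil_append]
          exact Or.inr (.yzx hza hac)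
      -- Here `x` bumps `a`, and `y` bumps some `b` from the tail because `z` was put there. If `z`
      -- bumps `d`, the outputs are `a d b` and `d a b` with `a ≤ b < d`.
      · by_cases hxa : x < a
        · simp only [rowInsertWord, rowInsert, hza, hxa, hxz.not_gt, hxy.not_gt, if_true, if_false,
            true_and, List.append_nil, Option.toList_some, List.cons_append, List.nil_append]
          obtain ⟨b, hbz, hb⟩ := bump_anti (r := r) hyz
          rw [hb]
          cases hz : (rowInsert z r).2 with
          | none => simp
          | some d =>
            refine Or.inr (.xzy (le_bump ?_ hb) (hbz.trans_lt (lt_of_rowInsert hz)))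
            intro c hc
            rcases mem_rowInsert hc with rfl | hc
            · exact not_lt.1 hza
            · exact hr.1 c hc
        · have hya : ¬ y < a := fun h => hxa (hxy.trans_lt h)
          simpa [rowInsertWord, rowInsert, hya, hza, hxa] using ih

theorem foldl_insertRows_knuth {w w' : List A} {T : List (List A)} (h : KnuthStep w w')
    (hT : ∀ r ∈ T, r.Pairwise (· ≤ ·)) :
    w.foldl (fun T x => insertRows x T) T = w'.foldl (fun T x => insertRows x T) T := by
  induction T generalizing w w' with
  | nil =>
    cases h with
    | yzx h1 h2 =>
      simp [insertRows, rowInsert, h1, h2.not_gt, (h1.trans_le h2).not_gt]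
    | xzy h1 h2 =>
      simp [insertRows, rowInsert, h2, h1.not_gt, (h1.trans_lt h2).not_gt, h1.trans_lt h2]
  | cons r T ih =>
    rw [List.forall_mem_cons] at hT
    obtain ⟨h1, h2⟩ := rowInsertWord_knuth h hT.1
    rw [foldl_insertRows_cons, foldl_insertRows_cons, h1]
    rcases h2 with h2 | h2
    · rw [h2]
    · rw [ih h2 hT.2]

/-! ### The insertion congruence and reading words -/

theorem rows_foldl_insert (w : List A) (T : Tableau A) :
    (w.foldl Tableau.insert T).rows = w.foldl (fun T x => insertRows x T) T.rows := by
  induction w generalizing T with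
  | nil => rfl
  | cons x w ih => exact ih _

theorem rows_P (w : FreeMonoid A) :
    (P w).rows = (FreeMonoid.toList w).foldl (fun T x => insertRows x T) [] :=
  rows_foldl_insert _ _

theorem P_mul (u v : FreeMonoid A) :
    P (u * v) = (FreeMonoid.toList v).foldl Tableau.insert (P u) := by
  simp [P, FreeMonoid.toList_mul]

/-- The congruence of words that give the same result when inserted into any tableau. -/
def insertionCon (A : Type*) [LinearOrder A] : Con (FreeMonoid A) where
  r u v := ∀ T : Tableau A, (FreeMonoid.toList u).foldl Tableau.insert T =
    (FreeMonoid.toList v).foldl Tableau.insert T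
  iseqv := ⟨fun _ _ => rfl, fun h T => (h T).symm, fun h h' T => (h T).trans (h' T)⟩
  mul' := by
    intro u v u' v' h h' T
    simp only [FreeMonoid.toList_mul, List.foldl_append]
    rw [h, h']

theorem insertionCon_of_knuthStep {w w' : List A} (h : KnuthStep w w') :
    insertionCon A (FreeMonoid.ofList w) (FreeMonoid.ofList w') := fun T =>
  Tableau.ext (by simpa [rows_foldl_insert] using foldl_insertRows_knuth h T.row_weak)

-- The letter `x` moves left past the letters of `r` one at a time by `yzx` moves, starting from the
-- right end.
open FreeMonoid in
theorem insertionCon_row_of_lt {x y : A} {r : List A} (hxy : x < y)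
    (hr : (y :: r).Pairwise (· ≤ ·)) :
    insertionCon A (ofList (y :: r) * of x) (of y * of x * ofList r) := by
  induction r generalizing y with
  | nil => exact (insertionCon A).refl _
  | cons z r ih =>
    have hyz : y ≤ z := (List.pairwise_cons.1 hr).1 z (by simp)
    have h1 := ih (hxy.trans_le hyz) (List.pairwise_cons.1 hr).2
    have h2 := insertionCon_of_knuthStep (KnuthStep.yzx hxy hyz)
    have h3 := (insertionCon A).mul ((insertionCon A).refl (of y)) h1
    have h4 := (insertionCon A).mul h2 ((insertionCon A).refl (ofList r))
    exact (insertionCon A).trans h3 h4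

open FreeMonoid in
/-- Inserting `x` into a row `r` amounts to rewriting `r x` as `b r'`, where `r'` is the new row
and `b` is the bumped letter. -/
theorem insertionCon_rowInsert (x : A) {r : List A} (hr : r.Pairwise (· ≤ ·)) :
    insertionCon A (ofList r * of x)
      (ofList (rowInsert x r).2.toList * ofList (rowInsert x r).1) := by
  induction r with
  | nil => exact (insertionCon A).refl _
  | cons y r ih =>
    by_cases hxy : x < y
    · simpa [rowInsert, hxy, ofList_cons, mul_assoc] using insertionCon_row_of_lt hxy hr
    · rw [List.pairwise_cons] at hr
      have h1 := (insertionCon A).mul ((insertionCon A).refl (of y)) (ih hr.2)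
      rw [← mul_assoc, ← ofList_cons] at h1
      refine (insertionCon A).trans h1 ?_
      simp only [rowInsert, hxy, if_false]
      cases hb : (rowInsert x r).2 with
      | none => exact (insertionCon A).refl _
      | some b =>
        have hxb := lt_of_rowInsert hb
        -- The bumped letter `b` must still cross `y`. The move `y b c → b y c` does this, with the
        -- head `c` of the new row as witness, since `y ≤ c ≤ x < b`.
        obtain ⟨c, s, hs, hyc, hcx⟩ : ∃ c s, (rowInsert x r).1 = c :: s ∧ y ≤ c ∧ c ≤ x := by
          cases r with
          | nil => exact ⟨x, [], rfl, not_lt.1 hxy, le_rfl⟩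
          | cons d r =>
            by_cases hxd : x < d
            · exact ⟨x, r, by simp [rowInsert, hxd], not_lt.1 hxy, le_rfl⟩
            · exact ⟨d, (rowInsert x r).1, by simp [rowInsert, hxd], hr.1 d (by simp),
                not_lt.1 hxd⟩
        rw [hs]
        have h2 := insertionCon_of_knuthStep (KnuthStep.xzy hyc (hcx.trans_lt hxb))
        have h3 := (insertionCon A).mul h2 ((insertionCon A).refl (ofList s))
        exact h3

/-- The row reading word of a list of rows, which reads the rows from top to bottom. -/
def readRows : List (List A) → FreeMonoid A
  | [] => 1
  | r :: T => readRows T * FreeMonoid.ofList r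

theorem insertionCon_insertRows (x : A) {T : List (List A)}
    (hT : ∀ r ∈ T, r.Pairwise (· ≤ ·)) :
    insertionCon A (readRows T * FreeMonoid.of x) (readRows (insertRows x T)) := by
  induction T generalizing x with
  | nil => exact (insertionCon A).refl _
  | cons r T ih =>
    rw [List.forall_mem_cons] at hT
    have h1 := (insertionCon A).mul ((insertionCon A).refl (readRows T))
      (insertionCon_rowInsert x hT.1)
    rw [← mul_assoc] at h1
    refine (insertionCon A).trans h1 ?_
    rw [insertRows]
    split
    · rename_i h
      rw [h]
      exact (insertionCon A).refl _
    · rename_i y h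
      rw [h, ← mul_assoc]
      exact (insertionCon A).mul (ih y hT.2) ((insertionCon A).refl _)

theorem insertionCon_readRows_foldl (w : List A) (T : Tableau A) :
    insertionCon A (readRows T.rows * FreeMonoid.ofList w)
      (readRows (w.foldl Tableau.insert T).rows) := by
  induction w generalizing T with
  | nil => simpa using (insertionCon A).refl _
  | cons x w ih =>
    have h := (insertionCon A).mul (insertionCon_insertRows x T.row_weak)
      ((insertionCon A).refl (FreeMonoid.ofList w))
    rw [mul_assoc] at h
    exact (insertionCon A).trans h (ih (T.insert x))

/-- One direction inserts into the empty tableau; for the other, each word is congruent to the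
reading word of its tableau. -/
theorem insertionCon_iff_P_eq {u v : FreeMonoid A} : insertionCon A u v ↔ P u = P v := by
  refine ⟨fun h => h _, fun h => ?_⟩
  have key (w : FreeMonoid A) : insertionCon A w (readRows (P w).rows) :=
    insertionCon_readRows_foldl (FreeMonoid.toList w) Tableau.empty
  exact (insertionCon A).trans (key u) (h ▸ (insertionCon A).symm (key v))

theorem P_mul_mul_eq {u v : FreeMonoid A} (h : P u = P v) (x y : FreeMonoid A) :
    P (x * u * y) = P (x * v * y) := by
  rw [← insertionCon_iff_P_eq] at h ⊢
  exact (insertionCon A).mul ((insertionCon A).mul ((insertionCon A).refl x) h)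
    ((insertionCon A).refl y)

/-! ### Restriction to a lower interval of the alphabet -/

theorem filter_lt_eq_nil {m y : A} {r : List A} (hmy : m ≤ y) (hr : ∀ z ∈ r, y ≤ z) :
    r.filter (· < m) = [] := by
  simpa [List.filter_eq_nil_iff] using fun z hz => hmy.trans (hr z hz)

theorem filter_rowInsert_of_le {m x : A} (hmx : m ≤ x) (r : List A) :
    (rowInsert x r).1.filter (· < m) = r.filter (· < m) := by
  induction r with
  | nil => simpa [rowInsert] using hmx
  | cons y r ih =>
    by_cases hxy : x < y
    · simp [rowInsert, hxy, hmx.not_gt, (hmx.trans hxy.le).not_gt]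
    · simp [rowInsert, hxy, List.filter_cons, ih]

/-- In a sorted row the letters below `m` form an initial segment. A bumped letter that is at least
`m` means that `x` lands at the end of this segment, so nothing is bumped from it. -/
theorem rowInsert_filter_of_lt {m x : A} (hxm : x < m) {r : List A} (hr : r.Pairwise (· ≤ ·)) :
    rowInsert x (r.filter (· < m)) =
      ((rowInsert x r).1.filter (· < m), (rowInsert x r).2.filter (· < m)) := by
  induction r with
  | nil => simp [rowInsert, hxm]
  | cons y r ih =>
    rw [List.pairwise_cons] at hr
    by_cases hxy : x < y
    · by_cases hym : y < m
      · simp [rowInsert, hxy, hym, hxm, Option.filter]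
      · simp [rowInsert, hxy, hym, hxm, filter_lt_eq_nil (not_lt.1 hym) hr.1, Option.filter]
    · have hym := (not_lt.1 hxy).trans_lt hxm
      simp [rowInsert, hxy, hym, ih hr.2]

/-- Filtering can leave empty rows on top. An empty row receives a letter just as a new row would,
so this padding is harmless. -/
theorem insertRows_append_replicate_nil (x : A) (Q : List (List A)) (k : ℕ) :
    ∃ k', insertRows x (Q ++ List.replicate k []) = insertRows x Q ++ List.replicate k' [] := by
  induction Q generalizing x with
  | nil =>
    cases k with
    | zero => exact ⟨0, rfl⟩
    | succ k => exact ⟨k, rfl⟩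
  | cons r Q ih =>
    rw [List.cons_append, insertRows, insertRows]
    split
    · exact ⟨k, rfl⟩
    · rename_i y _
      obtain ⟨k', h⟩ := ih y
      exact ⟨k', by rw [h, List.cons_append]⟩

/-- A letter at least `m` bumps only larger letters, so the part below `m` is untouched; a newly
created row filters to an empty one. -/
theorem map_filter_insertRows_of_le {m x : A} (hmx : m ≤ x) (T : List (List A)) :
    ∃ k, (insertRows x T).map (List.filter (· < m)) =
      T.map (List.filter (· < m)) ++ List.replicate k [] := by
  induction T generalizing x with
  | nil => exact ⟨1, by simpa [insertRows] using hmx⟩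
  | cons r T ih =>
    rw [insertRows]
    split
    · exact ⟨0, by simp [filter_rowInsert_of_le hmx]⟩
    · rename_i y hy
      obtain ⟨k, h⟩ := ih (hmx.trans (lt_of_rowInsert hy).le)
      exact ⟨k, by rw [List.map_cons, h, filter_rowInsert_of_le hmx]; rfl⟩

theorem map_filter_insertRows_of_lt {m x : A} (hxm : x < m) {T : List (List A)}
    (hT : ∀ r ∈ T, r.Pairwise (· ≤ ·)) :
    ∃ k, (insertRows x T).map (List.filter (· < m)) =
      insertRows x (T.map (List.filter (· < m))) ++ List.replicate k [] := by
  induction T generalizing x with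
  | nil => exact ⟨0, by simp [insertRows, hxm]⟩
  | cons r T ih =>
    rw [List.forall_mem_cons] at hT
    rw [insertRows, List.map_cons, insertRows, rowInsert_filter_of_lt hxm hT.1]
    cases hb : (rowInsert x r).2 with
    | none => exact ⟨0, by simp⟩
    | some y =>
      by_cases hym : y < m
      · obtain ⟨k, h⟩ := ih hym hT.2
        exact ⟨k, by simp [hym, h, Option.filter]⟩
      -- Once the bumped letter reaches `m`, insertion into the filtered rows has stopped.
      · obtain ⟨k, h⟩ := map_filter_insertRows_of_le (not_lt.1 hym) T
        exact ⟨k, by simp [hym, h, Option.filter]⟩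

/-- The restriction of a word to the letters that are smaller than `m`. -/
def below (m : A) (w : FreeMonoid A) : FreeMonoid A :=
  FreeMonoid.ofList ((FreeMonoid.toList w).filter (· < m))

theorem map_filter_foldl_insert (m : A) (w : List A) {T : Tableau A} {Q : List (List A)}
    (h : ∃ k, T.rows.map (List.filter (· < m)) = Q ++ List.replicate k []) :
    ∃ k, (w.foldl Tableau.insert T).rows.map (List.filter (· < m)) =
      (w.filter (· < m)).foldl (fun T x => insertRows x T) Q ++ List.replicate k [] := by
  induction w generalizing T Q with
  | nil => exact h
  | cons x w ih =>
    obtain ⟨k, hk⟩ := h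
    by_cases hxm : x < m
    · rw [List.filter_cons_of_pos (by simpa using hxm)]
      refine ih (T := T.insert x) ?_
      obtain ⟨k₁, h₁⟩ := map_filter_insertRows_of_lt hxm T.row_weak
      obtain ⟨k₂, h₂⟩ := insertRows_append_replicate_nil x Q k
      rw [hk, h₂, List.append_assoc, List.replicate_append_replicate] at h₁
      exact ⟨_, h₁⟩
    · rw [List.filter_cons_of_neg (by simpa using hxm)]
      refine ih (T := T.insert x) ?_
      obtain ⟨k₁, h₁⟩ := map_filter_insertRows_of_le (not_lt.1 hxm) T.rows
      rw [hk, List.append_assoc, List.replicate_append_replicate] at h₁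
      exact ⟨_, h₁⟩

/-- The letters smaller than `m` in `P w` form the tableau of the restriction of `w` to these
letters. -/
theorem map_filter_rows_P (m : A) (w : FreeMonoid A) :
    ∃ k, (P w).rows.map (List.filter (· < m)) = (P (below m w)).rows ++ List.replicate k [] := by
  rw [rows_P (below m w)]
  exact map_filter_foldl_insert m _ ⟨0, rfl⟩

theorem bump_mem {x y : A} {r : List A} (h : (rowInsert x r).2 = some y) : y ∈ r := by
  induction r with
  | nil => simp [rowInsert] at h
  | cons c r ih =>
    by_cases hxc : x < c
    · simp only [rowInsert, hxc, if_true, Option.some.injEq] at h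
      simp [h]
    · simp only [rowInsert, hxc, if_false] at h
      simp [ih h]

theorem mem_of_mem_insertRows {x z : A} {r : List A} {T : List (List A)}
    (hr : r ∈ insertRows x T) (hz : z ∈ r) : z = x ∨ ∃ s ∈ T, z ∈ s := by
  induction T generalizing x with
  | nil =>
    rw [insertRows, List.mem_singleton] at hr
    subst hr
    exact Or.inl (List.mem_singleton.1 hz)
  | cons s T ih =>
    have head (h : r = (rowInsert x s).1) : z = x ∨ ∃ t ∈ s :: T, z ∈ t := by
      subst h
      exact (mem_rowInsert hz).imp_right fun h => ⟨s, by simp, h⟩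
    cases hb : (rowInsert x s).2 with
    | none =>
      rw [insertRows, hb] at hr
      exact (List.mem_cons.1 hr).elim head fun hr => Or.inr ⟨r, by simp [hr], hz⟩
    | some y =>
      rw [insertRows, hb] at hr
      rcases List.mem_cons.1 hr with hr | hr
      · exact head hr
      rcases ih hr with rfl | ⟨t, ht, hzt⟩
      · exact Or.inr ⟨s, by simp, bump_mem hb⟩
      · exact Or.inr ⟨t, by simp [ht], hzt⟩

theorem mem_of_mem_rows_foldl (w : List A) (T : Tableau A) {r : List A} {z : A}
    (hr : r ∈ (w.foldl Tableau.insert T).rows) (hz : z ∈ r) : z ∈ w ∨ ∃ s ∈ T.rows, z ∈ s := by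
  induction w generalizing T with
  | nil => exact Or.inr ⟨r, hr, hz⟩
  | cons x w ih =>
    rcases ih (T.insert x) hr with h | ⟨s, hs, hzs⟩
    · simp [h]
    · rcases mem_of_mem_insertRows hs hzs with rfl | h
      · simp
      · exact Or.inr h

theorem mem_of_mem_rows_P {w : FreeMonoid A} {r : List A} {z : A} (hr : r ∈ (P w).rows)
    (hz : z ∈ r) : z ∈ FreeMonoid.toList w := by
  rcases mem_of_mem_rows_foldl _ _ hr hz with h | ⟨s, hs, -⟩
  · exact h
  · simp [Tableau.empty] at hs

/-- A row with greatest letter at most `m` consists of its letters smaller than `m`, followed by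
copies of `m`. -/
theorem row_eq_filter_append {m : A} {r : List A} (hr : r.Pairwise (· ≤ ·))
    (hm : ∀ z ∈ r, z ≤ m) :
    r = r.filter (· < m) ++ List.replicate (r.length - (r.filter (· < m)).length) m := by
  induction r with
  | nil => rfl
  | cons y r ih =>
    rw [List.pairwise_cons] at hr
    rw [List.forall_mem_cons] at hm
    by_cases hym : y < m
    · rw [List.filter_cons_of_pos (by simpa using hym), List.length_cons, List.length_cons,
        Nat.add_sub_add_right, List.cons_append, ← ih hr.2 hm.2]
    · have hy : y = m := hm.1.antisymm (not_lt.1 hym)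
      subst hy
      rw [List.filter_cons_of_neg (by simp), filter_lt_eq_nil le_rfl hr.1]
      simp only [List.length_cons, List.length_nil, Nat.sub_zero, List.nil_append,
        List.eq_replicate_iff, List.mem_cons, forall_eq_or_imp, true_and]
      exact fun z hz => (hm.2 z hz).antisymm (hr.1 z hz)

theorem rows_eq_of_map_filter_eq {m : A} {T T' : List (List A)}
    (hT : ∀ r ∈ T, r.Pairwise (· ≤ ·)) (hT' : ∀ r ∈ T', r.Pairwise (· ≤ ·))
    (hm : ∀ r ∈ T, ∀ z ∈ r, z ≤ m) (hm' : ∀ r ∈ T', ∀ z ∈ r, z ≤ m)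
    (hlen : T.map List.length = T'.map List.length)
    (hfilter : T.map (List.filter (· < m)) = T'.map (List.filter (· < m))) : T = T' := by
  induction T generalizing T' with
  | nil => simpa [eq_comm] using hlen
  | cons r T ih =>
    cases T' with
    | nil => simp at hlen
    | cons r' T' =>
      rw [List.forall_mem_cons] at hT hT' hm hm'
      simp only [List.map_cons, List.cons.injEq] at hlen hfilter
      rw [ih hT.2 hT'.2 hm.2 hm'.2 hlen.2 hfilter.2, row_eq_filter_append hT.1 hm.1,
        row_eq_filter_append hT'.1 hm'.1, hlen.1, hfilter.1]

/-! ### Row lengths -/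

/-- The list of the row lengths of a tableau. -/
def Tableau.rowLengths (T : Tableau A) : List ℕ := T.rows.map List.length

theorem Fits.length_le {r s : List A} (h : Fits r s) : s.length ≤ r.length := by
  induction r generalizing s with
  | nil => cases s with
    | nil => rfl
    | cons b s => exact h.elim
  | cons a r ih => cases s with
    | nil => simp
    | cons b s => simpa using ih h.2

theorem Tableau.rowLengths_pairwise (T : Tableau A) : T.rowLengths.Pairwise (· ≥ ·) := by
  rw [← List.isChain_iff_pairwise, rowLengths, List.isChain_map]
  exact T.col_strict.imp fun _ _ h => h.length_le

theorem partitions_ext {p q : Partitions} (h : p.2.parts = q.2.parts) : p = q := by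
  obtain ⟨n, p⟩ := p
  obtain ⟨k, q⟩ := q
  obtain rfl : n = k := by rw [← p.parts_sum, ← q.parts_sum, h]
  exact congrArg (Sigma.mk n) (Nat.Partition.ext h)

/-- Row lengths decrease weakly, so their multiset determines their order. -/
theorem Tableau.shape_eq_iff {T T' : Tableau A} :
    T.shape = T'.shape ↔ T.rowLengths = T'.rowLengths := by
  constructor
  · intro h
    have h' : (T.rowLengths : Multiset ℕ) = T'.rowLengths :=
      congrArg (fun p : Partitions => p.2.parts) h
    exact (Multiset.coe_eq_coe.1 h').eq_of_pairwise' T.rowLengths_pairwise T'.rowLengths_pairwise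
  · intro h
    exact partitions_ext (congrArg ((↑) : List ℕ → Multiset ℕ) h)

/-- A tableau over letters at most `m` is determined by its shape and the tableau of its letters
smaller than `m`. -/
theorem P_eq_of_below {m : A} {u v : FreeMonoid A} (hu : ∀ z ∈ FreeMonoid.toList u, z ≤ m)
    (hv : ∀ z ∈ FreeMonoid.toList v, z ≤ m) (hshape : shape u = shape v)
    (hbelow : P (below m u) = P (below m v)) : P u = P v := by
  have hlen := Tableau.shape_eq_iff.1 hshape
  refine Tableau.ext (rows_eq_of_map_filter_eq (m := m) (P u).row_weak (P v).row_weak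
    (fun r hr z hz => hu z (mem_of_mem_rows_P hr hz))
    (fun r hr z hz => hv z (mem_of_mem_rows_P hr hz)) hlen ?_)
  obtain ⟨k, hk⟩ := map_filter_rows_P m u
  obtain ⟨l, hl⟩ := map_filter_rows_P m v
  rw [hbelow] at hk
  -- Equal shapes have equally many rows, which forces the two numbers of padding rows to agree.
  have h1 := congrArg List.length hlen
  have h2 := congrArg List.length hk
  have h3 := congrArg List.length hl
  simp only [Tableau.rowLengths, List.length_map, List.length_append, List.length_replicate]
    at h1 h2 h3
  rw [hk, hl, show k = l by omega]

/-! ### Words with a large power of the greatest letter in front -/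

/-- The rows of `Q`, preceded by a first row length `L`, and filled up with copies of `m` such
that the first row has length `L` and each further row has the length of the preceding row of
`Q`. -/
def fillRows (m : A) : ℕ → List (List A) → List (List A)
  | 0, [] => []
  | L + 1, [] => [List.replicate (L + 1) m]
  | L, q :: Q => (q ++ List.replicate (L - q.length) m) :: fillRows m q.length Q

theorem rowInsert_append_of_bump {x y : A} {q : List A} (h : (rowInsert x q).2 = some y)
    (s : List A) : rowInsert x (q ++ s) = ((rowInsert x q).1 ++ s, some y) := by
  induction q with
  | nil => simp [rowInsert] at h
  | cons a q ih =>
    by_cases hxa : x < a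
    · simpa [rowInsert, hxa] using h
    · simp only [rowInsert, hxa, if_false] at h
      simp [rowInsert, hxa, ih h]

theorem rowInsert_append_of_none {x : A} {q : List A} (h : (rowInsert x q).2 = none)
    (s : List A) : rowInsert x (q ++ s) = (q ++ (rowInsert x s).1, (rowInsert x s).2) := by
  induction q with
  | nil => simp
  | cons a q ih =>
    by_cases hxa : x < a
    · simp [rowInsert, hxa] at h
    · simp only [rowInsert, hxa, if_false] at h
      simp [rowInsert, hxa, ih h]

theorem rowInsert_of_none {x : A} {q : List A} (h : (rowInsert x q).2 = none) :
    (rowInsert x q).1 = q ++ [x] := by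
  simpa [rowInsert] using congrArg Prod.fst (rowInsert_append_of_none h [])

theorem length_rowInsert_of_bump {x y : A} {q : List A} (h : (rowInsert x q).2 = some y) :
    (rowInsert x q).1.length = q.length := by
  induction q with
  | nil => simp [rowInsert] at h
  | cons a q ih =>
    by_cases hxa : x < a
    · simp [rowInsert, hxa]
    · simp only [rowInsert, hxa, if_false] at h
      simp [rowInsert, hxa, ih h]

theorem rowInsert_of_forall_le {m : A} {q : List A} (hq : ∀ z ∈ q, z ≤ m) :
    rowInsert m q = (q ++ [m], none) := by
  induction q with
  | nil => rfl
  | cons a q ih =>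
    rw [List.forall_mem_cons] at hq
    simp [rowInsert, hq.1.not_gt, ih hq.2]

/-- Inserting the greatest letter. -/
theorem insertRows_fillRows_self {m : A} {L : ℕ} {Q : List (List A)}
    (hQ : ∀ r ∈ Q, ∀ z ∈ r, z < m) (hL : (Q.headD []).length ≤ L) :
    insertRows m (fillRows m L Q) = fillRows m (L + 1) Q := by
  have hrep (k : ℕ) : ∀ z ∈ List.replicate k m, z ≤ m := fun z hz =>
    (List.eq_of_mem_replicate hz).le
  cases Q with
  | nil =>
    cases L with
    | zero => rfl
    | succ L =>
      rw [fillRows, insertRows, rowInsert_of_forall_le (hrep _)]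
      simp [fillRows, List.replicate_succ' (n := L + 1)]
  | cons q Q =>
    rw [List.forall_mem_cons] at hQ
    have hqL : q.length ≤ L := hL
    rw [fillRows, insertRows, rowInsert_of_forall_le]
    · simp [fillRows, Nat.succ_sub hqL, List.replicate_succ']
    · intro z hz
      rcases List.mem_append.1 hz with hz | hz
      · exact (hQ.1 z hz).le
      · exact hrep _ z hz

/-- Inserting a smaller letter. -/
theorem insertRows_fillRows_of_lt {m x : A} (hxm : x < m) {L : ℕ} {Q : List (List A)}
    (hQ : ∀ r ∈ Q, ∀ z ∈ r, z < m)
    (hlen : Q.IsChain fun r s => s.length ≤ r.length)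
    (hlen' : (insertRows x Q).IsChain fun r s => s.length ≤ r.length)
    (hL : ((insertRows x Q).headD []).length ≤ L) :
    insertRows x (fillRows m L Q) = fillRows m L (insertRows x Q) := by
  induction Q generalizing x L with
  | nil =>
    cases L with
    | zero => simp [insertRows] at hL
    | succ L => simp [fillRows, insertRows, rowInsert, hxm, List.replicate_succ]
  | cons q Q ih =>
    rw [List.forall_mem_cons] at hQ
    cases hb : (rowInsert x q).2 with
    | none =>
      rw [insertRows, hb] at hL ⊢
      simp only [List.headD_cons] at hL
      rw [rowInsert_of_none hb, List.length_append, List.length_singleton] at hL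
      -- The bound concerns the row after insertion, so at least one copy of `m` is available to be
      -- bumped.
      obtain ⟨k, rfl⟩ := Nat.exists_eq_add_of_le hL
      have hk : q.length + 1 + k - q.length = k + 1 := by omega
      rw [fillRows, hk, List.replicate_succ, insertRows, rowInsert_append_of_none hb]
      simp only [rowInsert, hxm, if_true]
      -- The bumped `m` lengthens the next filled row by one, exactly as `q` grew by one.
      rw [insertRows_fillRows_self hQ.2, rowInsert_of_none hb]
      · simp [fillRows]
      · cases Q with
        | nil => simp
        | cons s Q => exact (List.isChain_cons_cons.1 hlen).1
    | some y =>
      have hym : y < m := hQ.1 y (bump_mem hb)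
      have hl := length_rowInsert_of_bump hb
      rw [insertRows, hb] at hL hlen' ⊢
      simp only at hlen' ⊢
      rw [fillRows, insertRows, rowInsert_append_of_bump hb, fillRows, hl]
      simp only
      rw [ih hym hQ.2 hlen.tail hlen'.tail]
      rw [← hl]
      cases hI : insertRows y Q with
      | nil => simp
      | cons s S =>
        rw [hI] at hlen'
        exact (List.isChain_cons_cons.1 hlen').1

/-- Each filled row takes the length of the preceding row of `Q`, and the final row of `Q` supports
one extra row of copies of `m`. The bounds keep the natural subtractions from truncating, and
nonemptiness ensures that the extra row exists. -/
theorem map_length_fillRows {B : Type*} (m : B) {L : ℕ} {Q : List (List B)} (hL : L ≠ 0)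
    (hne : ∀ r ∈ Q, r ≠ []) (hlen : Q.IsChain fun r s => s.length ≤ r.length)
    (hhead : (Q.headD []).length ≤ L) :
    (fillRows m L Q).map List.length = L :: Q.map List.length := by
  induction Q generalizing L with
  | nil =>
    obtain ⟨L, rfl⟩ := Nat.exists_eq_succ_of_ne_zero hL
    simp [fillRows]
  | cons q Q ih =>
    rw [List.forall_mem_cons] at hne
    have hq : q.length ≤ L := hhead
    rw [fillRows, List.map_cons, ih (by simpa using hne.1) hne.2 hlen.tail]
    · simp [hq]
    · cases Q with
      | nil => simp
      | cons s Q => exact (List.isChain_cons_cons.1 hlen).1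

theorem headD_insertRows (x : A) (T : List (List A)) :
    (insertRows x T).headD [] = (rowInsert x (T.headD [])).1 := by
  cases T with
  | nil => rfl
  | cons r T => rw [insertRows]; split <;> rfl

theorem length_rowInsert_le (x : A) (r : List A) : (rowInsert x r).1.length ≤ r.length + 1 := by
  cases h : (rowInsert x r).2 with
  | none => simp [rowInsert_of_none h]
  | some y => simp [length_rowInsert_of_bump h]

theorem Tableau.isChain_length (T : Tableau A) :
    T.rows.IsChain fun r s => s.length ≤ r.length :=
  T.col_strict.imp fun _ _ h => h.length_le

/-- Inserting a word into a tableau that is filled up with enough copies of the greatest letter: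
the letters below the greatest one are inserted into the tableau of letters below it. -/
theorem foldl_insertRows_fillRows {m : A} {w : List A} (hw : ∀ z ∈ w, z ≤ m) {T : Tableau A}
    (hT : ∀ r ∈ T.rows, ∀ z ∈ r, z < m) {L : ℕ}
    (hL : (T.rows.headD []).length + w.length ≤ L) :
    ∃ L' ≥ L, (((w.filter (· < m)).foldl Tableau.insert T).rows.headD []).length ≤ L' ∧
      w.foldl (fun T x => insertRows x T) (fillRows m L T.rows) =
        fillRows m L' ((w.filter (· < m)).foldl Tableau.insert T).rows := by
  induction w generalizing T L with
  | nil => exact ⟨L, le_rfl, by simpa using hL, rfl⟩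
  | cons x w ih =>
    rw [List.forall_mem_cons] at hw
    rw [List.length_cons] at hL
    by_cases hxm : x < m
    · rw [List.filter_cons_of_pos (by simpa using hxm), List.foldl_cons, List.foldl_cons]
      -- Each small letter lengthens the first row by at most one, so the slack `w.length` never
      -- runs out.
      have hle : ((insertRows x T.rows).headD []).length ≤ (T.rows.headD []).length + 1 :=
        headD_insertRows x T.rows ▸ length_rowInsert_le _ _
      rw [insertRows_fillRows_of_lt hxm hT T.isChain_length (T.insert x).isChain_length
        (by omega)]
      refine ih hw.2 (T := T.insert x) ?_ ?_
      · intro r hr z hz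
        rcases mem_of_mem_insertRows hr hz with rfl | ⟨s, hs, hzs⟩
        · exact hxm
        · exact hT s hs z hzs
      · change ((insertRows x T.rows).headD []).length + w.length ≤ L
        omega
    · obtain rfl : x = m := hw.1.antisymm (not_lt.1 hxm)
      rw [List.filter_cons_of_neg (by simp), List.foldl_cons,
        insertRows_fillRows_self hT (by omega)]
      obtain ⟨L', h1, h2⟩ := ih hw.2 hT (L := L + 1) (by omega)
      exact ⟨L', by omega, h2⟩

theorem foldl_insertRows_replicate (m : A) (N : ℕ) :
    (List.replicate N m).foldl (fun T x => insertRows x T) [] = fillRows m N [] := by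
  induction N with
  | zero => rfl
  | succ N ih =>
    rw [List.replicate_succ', List.foldl_append, ih]
    exact insertRows_fillRows_self (by simp) (by simp)

/-- Multiplying a word by a large power of its greatest letter `m` on the left gives a tableau
whose shape is that of the tableau of the letters smaller than `m`, with a row added below. -/
theorem rowLengths_P_replicate_mul {m : A} {w : FreeMonoid A}
    (hw : ∀ z ∈ FreeMonoid.toList w, z ≤ m) {N : ℕ} (hN : (FreeMonoid.toList w).length < N) :
    ∃ L, (P (FreeMonoid.ofList (List.replicate N m) * w)).rowLengths =
      L :: (P (below m w)).rowLengths := by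
  obtain ⟨L, hL, hhead, h⟩ := foldl_insertRows_fillRows hw (T := Tableau.empty)
    (by simp [Tableau.empty]) (L := N) (by simpa [Tableau.empty] using hN.le)
  refine ⟨L, ?_⟩
  have hrows : (P (FreeMonoid.ofList (List.replicate N m) * w)).rows =
      fillRows m L (P (below m w)).rows := by
    rw [rows_P, FreeMonoid.toList_mul, List.foldl_append, FreeMonoid.toList_ofList,
      foldl_insertRows_replicate]
    exact h
  rw [Tableau.rowLengths, hrows]
  exact map_length_fillRows m (by omega) (P (below m w)).rows_ne_nil
    (P (below m w)).isChain_length hhead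

/-- The shapes of the words `m ^ N w` determine the shape of the restriction of `w` to the letters
smaller than its greatest letter `m`. -/
theorem shape_below_eq {m : A} {u v : FreeMonoid A} (hu : ∀ z ∈ FreeMonoid.toList u, z ≤ m)
    (hv : ∀ z ∈ FreeMonoid.toList v, z ≤ m)
    (h : ∀ N, shape (FreeMonoid.ofList (List.replicate N m) * u) =
      shape (FreeMonoid.ofList (List.replicate N m) * v)) :
    shape (below m u) = shape (below m v) := by
  -- A single exponent exceeding both lengths serves `u` and `v` at once.
  let N := (FreeMonoid.toList u).length + (FreeMonoid.toList v).length + 1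
  obtain ⟨L, hL⟩ := rowLengths_P_replicate_mul hu (N := N) (by omega)
  obtain ⟨K, hK⟩ := rowLengths_P_replicate_mul hv (N := N) (by omega)
  have := Tableau.shape_eq_iff.1 (h N)
  rw [hL, hK] at this
  exact Tableau.shape_eq_iff.2 (List.cons.inj this).2

/-! ### Induction on the alphabet -/

theorem below_mul (m : A) (u v : FreeMonoid A) : below m (u * v) = below m u * below m v := by
  simp [below, FreeMonoid.toList_mul, FreeMonoid.ofList_append]

theorem below_of_forall_lt {m : A} {w : FreeMonoid A} (h : ∀ z ∈ FreeMonoid.toList w, z < m) :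
    below m w = w := by
  rw [below, List.filter_eq_self.2 (by simpa using h), FreeMonoid.ofList_toList]

theorem mem_below {m z : A} {w : FreeMonoid A} :
    z ∈ FreeMonoid.toList (below m w) ↔ z ∈ FreeMonoid.toList w ∧ z < m := by
  simp [below]

/-- Words over `S` that cannot be distinguished by the shapes of their left multiples by words
over `S` have the same tableau. -/
theorem P_eq_of_shape_mul_eq (S : Finset A) {u v : FreeMonoid A}
    (hu : ∀ z ∈ FreeMonoid.toList u, z ∈ S) (hv : ∀ z ∈ FreeMonoid.toList v, z ∈ S)
    (h : ∀ x : FreeMonoid A, (∀ z ∈ FreeMonoid.toList x, z ∈ S) → shape (x * u) = shape (x * v)) :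
    P u = P v := by
  induction S using Finset.induction_on_max generalizing u v with
  | empty =>
    have hu' := List.eq_nil_iff_forall_not_mem.2 fun z hz => Finset.notMem_empty z (hu z hz)
    have hv' := List.eq_nil_iff_forall_not_mem.2 fun z hz => Finset.notMem_empty z (hv z hz)
    rw [FreeMonoid.toList.injective (hu'.trans hv'.symm)]
  | insert m S hS ih =>
    have hle {w : FreeMonoid A} (hw : ∀ z ∈ FreeMonoid.toList w, z ∈ insert m S) :
        ∀ z ∈ FreeMonoid.toList w, z ≤ m := fun z hz =>
      (Finset.mem_insert.1 (hw z hz)).elim le_of_eq fun h => (hS z h).le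
    have hmem {w : FreeMonoid A} (hw : ∀ z ∈ FreeMonoid.toList w, z ∈ insert m S) :
        ∀ z ∈ FreeMonoid.toList (below m w), z ∈ S := fun z hz =>
      Finset.mem_of_mem_insert_of_ne (hw z (mem_below.1 hz).1) (mem_below.1 hz).2.ne
    have hmul {x w : FreeMonoid A} (hx : ∀ z ∈ FreeMonoid.toList x, z ∈ insert m S)
        (hw : ∀ z ∈ FreeMonoid.toList w, z ∈ insert m S) :
        ∀ z ∈ FreeMonoid.toList (x * w), z ∈ insert m S := fun z hz => by
      rw [FreeMonoid.toList_mul, List.mem_append] at hz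
      exact hz.elim (hx z) (hw z)
    refine P_eq_of_below (hle hu) (hle hv) (by simpa using h 1 (by simp))
      (ih (hmem hu) (hmem hv) fun x hx => ?_)
    have hx' : ∀ z ∈ FreeMonoid.toList x, z ∈ insert m S := fun z hz =>
      Finset.mem_insert_of_mem (hx z hz)
    -- As `x` has only letters below `m`, it equals its own restriction, and `x * below m u` is the
    -- restriction of `x * u`. The left factors `m ^ N * x` are then words over the larger alphabet.
    rw [← below_of_forall_lt fun z hz => hS z (hx z hz), ← below_mul, ← below_mul]
    refine shape_below_eq (hle (hmul hx' hu)) (hle (hmul hx' hv)) fun N => ?_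
    rw [← mul_assoc, ← mul_assoc]
    refine h _ (hmul (fun z hz => ?_) hx')
    rw [FreeMonoid.toList_ofList] at hz
    exact List.eq_of_mem_replicate hz ▸ Finset.mem_insert_self m S

theorem leftSyntactic_shape (A : Type*) [LinearOrder A] [Finite A] :
    leftSyntactic (shape (A := A)) = placticSetoid A := by
  have := Fintype.ofFinite A
  ext u v
  refine ⟨fun h => P_eq_of_shape_mul_eq Finset.univ (by simp) (by simp) fun x _ => h x,
    fun h x => ?_⟩
  simpa [shape] using congrArg Tableau.shape (P_mul_mul_eq h x 1)

theorem syntacticCon_shape (A : Type*) [LinearOrder A] [Finite A] :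
    (syntacticCon (shape (A := A))).toSetoid = placticSetoid A := by
  ext u v
  refine ⟨fun h => ?_, fun h x y => congrArg Tableau.shape (P_mul_mul_eq h x y)⟩
  rw [← leftSyntactic_shape]
  exact fun x => by simpa using h x 1

end Plactic

theorem theorem14p1 (A : Type*) [LinearOrder A] [Finite A] :
    -- the left syntactic congruence of the shape function is the plactic congruence
    Plactic.leftSyntactic (Plactic.shape (A := A)) = Plactic.placticSetoid A ∧
    -- the plactic equivalence is the (two-sided) syntactic congruence of the shape function
    (Plactic.syntacticCon (Plactic.shape (A := A))).toSetoid = Plactic.placticSetoid A ∧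
    -- the plactic equivalence is a monoid congruence `c`, and the plactic monoid (the quotient of
    -- the free monoid by `c`) is canonically the syntactic monoid of the shape function
    ∃ c : Con (FreeMonoid A), c.toSetoid = Plactic.placticSetoid A ∧
      ∃ e : c.Quotient ≃* Plactic.SyntacticMonoid (Plactic.shape (A := A)),
        ∀ w : FreeMonoid A, e (c.mk' w) = (Plactic.syntacticCon (Plactic.shape (A := A))).mk' w :=
  -- The congruence `c` is chosen to be `syntacticCon` itself, so the isomorphism is the identity.
  ⟨Plactic.leftSyntactic_shape A, Plactic.syntacticCon_shape A, _, Plactic.syntacticCon_shape A,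
    MulEquiv.refl _, fun _ => rfl⟩
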